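/- Let $\mathcal M$ be a unital O$^*$-algebra on a dense subspace $\mathcal D$ of a complex Hilbert space $\mathcal H$, i.e. a unital algebra of linear maps $\mathcal D\to\mathcal D$ such that each $\hat A\in\mathcal M$ satisfies $\mathcal D\subset \mathrm{dom}(\hat A^*)$ and $\hat A^*|_{\mathcal D}\in\mathcal M$. Let $\mathcal T_1(\mathcal M)$ be the set of trace class operators $\hat T$ on $\mathcal H$ with $\hat T\mathcal H\subset\mathcal D$, $\hat T^*\mathcal H\subset\mathcal D$ and with $\hat B\hat T$, $\hat B\hat T^*$ of trace class for all $\hat B\in\mathcal M$. Let $X=\mathcal E_S(\mathcal M)$ be the set of positive operators of trace one in $\mathcal T_1(\mathcal M)$, with the coarsest topology for which $\hat\rho\mapsto \mathrm{Tr}\,\hat B\hat\rho$ is continuous for all $\hat B\in\mathcal M$. Let $\hat A\in\mathcal M$ be essentially self-adjoint, and let $a_Q:X\to\mathbb R$, $a_Q(\hat\rho)=\mathrm{Tr}\,\hat A\hat\rho$. Identify the sheaf of Dedekind reals $\mathbb R_D(X)$ with the sheaf of continuous real functions on $X$, and let $R=\mathbb R_D^{a_Q}(X)$ be the subsheaf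 generated by $a_Q$: its sections over an open $U\subset X$ are the continuous functions $f:U\to\mathbb R$ that are locally of the form $F\circ a_Q$ with $F:\mathbb R\to\mathbb R$ continuous. Suppose that the closure of the numerical range $\{\langle\hat Au,u\rangle : u\in\mathcal D,\ \|u\|=1\}$ is $\mathbb R$. Then $X\ne\emptyset$ and $R$ is a continuum of real numbers, i.e. it is a subsheaf of $\mathbb R_D(X)$ for which the following hold (in the internal logic of sheaves on $X$: existence and disjunction are local, and a negation holds on $U$ if the statement holds on no non-empty open subset of $U$). 1. $R$ contains the sheaves $\mathbb Z(X)$ and $\mathbb Q(X)$ of locally constant functions with values in $\mathbb Z$ and $\mathbb Q$. 2. The orders of the Dedekind reals ($f<g$ iff there is a rational in the upper cut of $f$ and in the lower cut of $g$; $f\le g$ iff the upper cut of $g$ is contained in that of $f$ and the lower cut of $f$ in that of $g$) restrict to a strict partial order $<$ and a partial order $\le$ on $R$; they are local, $f\le g$ is equivalent to $\neg(g<f)$, and on $\mathbb Q(X)$ they are the usual orders. 3. $R$ is a residue field: it is closed under the ring operations, $0\neq1$, and if $b\in R$ is not invertible in $R$, then $b=0$. It is an apartness field: $b\in R$ is invertible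 in $R$ if and only if $|b|>0$. 4. $R$ is closed under $|f|=\max(f,-f)$, and $d(f,g)=|f-g|$ is a metric on $R$ for which $R$ is complete (every Cauchy sequence of sections over an open set $U$ has a unique limit in $R(U)$) and $\mathbb Q(X)$ is dense in $R$: for $f\in R(U)$ and each integer $n>0$ there are an open cover $(U_j)$ of $U$ and locally constant $q_j:U_j\to\mathbb Q$ with $|f|_{U_j}-q_j|<1/n$. Moreover, for any rationals $r_1<r_2$ there are infinitely many non-empty open sets $W\subset X$ with $r_1<a_Q|_W<r_2$. -/

import Mathlib

open TopologicalSpace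
open scoped InnerProductSpace

noncomputable section

/-! Trace class operators on a Hilbert space. -/

section TraceClass

variable (H : Type*) [NormedAddCommGroup H] [InnerProductSpace ℂ H] [CompleteSpace H]

/-- The index set of a fixed orthonormal basis of `H`. -/
def basisIndex : Set H := (exists_hilbertBasis ℂ H).choose

/-- A fixed orthonormal basis of `H`. Traces of trace class operators, and the property of being
of trace class, do not depend on its choice. -/
def stdHilbertBasis : HilbertBasis (basisIndex H) ℂ H :=
  (exists_hilbertBasis ℂ H).choose_spec.choose

variable {H}

/-- `T` is of trace class: `Tr |T| < ∞`, with `|T| = √(T* T)`. -/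
def IsTraceClass (T : H →L[ℂ] H) : Prop :=
  Summable fun i => (⟪stdHilbertBasis H i, CFC.abs T (stdHilbertBasis H i)⟫_ℂ).re

/-- The trace `Tr L = ∑ ⟪eᵢ, L eᵢ⟫` of an everywhere defined operator
(used for trace class operators only). -/
def opTrace (L : H →ₗ[ℂ] H) : ℂ :=
  ∑' i, ⟪stdHilbertBasis H i, L (stdHilbertBasis H i)⟫_ℂ

end TraceClass

/-! O*-algebras, their states and the functions `a_Q`. -/

/-- A unital O*-algebra on a dense subspace `dom` of `H`: a unital algebra of linear maps of `dom`
into itself in which every `A` has an adjoint `A† = A*|dom`, again in the algebra. -/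
structure OStarAlgebra (H : Type*) [NormedAddCommGroup H] [InnerProductSpace ℂ H] where
  dom : Submodule ℂ H
  dense_dom : Dense (dom : Set H)
  alg : Subalgebra ℂ (Module.End ℂ dom)
  adjoint_mem : ∀ A ∈ alg, ∃ B ∈ alg, ∀ x y : dom, ⟪(A x : H), (y : H)⟫_ℂ = ⟪(x : H), (B y : H)⟫_ℂ

namespace OStarAlgebra

variable {H : Type*} [NormedAddCommGroup H] [InnerProductSpace ℂ H] (M : OStarAlgebra H)

/-- A linear map of `dom` into itself as an unbounded operator in `H` with domain `dom`. -/
def toLinearPMap (A : Module.End ℂ M.dom) : H →ₗ.[ℂ] H :=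
  ⟨M.dom, M.dom.subtype ∘ₗ A⟩

/-- The numerical range `Θ(A)`. -/
def numericalRange (A : Module.End ℂ M.dom) : Set ℂ :=
  {z | ∃ u : M.dom, ‖u‖ = 1 ∧ ⟪(u : H), (A u : H)⟫_ℂ = z}

/-- The everywhere defined operator `A T`, for `T` with range in `dom`. -/
def compOp (A : Module.End ℂ M.dom) (T : H →L[ℂ] H) (hT : ∀ x, T x ∈ M.dom) : H →ₗ[ℂ] H :=
  M.dom.subtype ∘ₗ A ∘ₗ (T : H →ₗ[ℂ] H).codRestrict M.dom hT

variable [CompleteSpace H]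

/-- `A` is essentially self-adjoint: its closure is self-adjoint. -/
def IsEssentiallySelfAdjoint (A : Module.End ℂ M.dom) : Prop :=
  IsSelfAdjoint (M.toLinearPMap A).closure

/-- Membership in `T₁(M)`: `T` is bounded, `T` and `T*` map `H` into `dom`, and `A T`, `A T*` are
(bounded and) of trace class for all `A ∈ M`. -/
structure MemT1 (T : H →L[ℂ] H) : Prop where
  range_mem : ∀ x, T x ∈ M.dom
  adjoint_range_mem : ∀ x, ContinuousLinearMap.adjoint T x ∈ M.dom
  traceClass : ∀ A ∈ M.alg, ∃ B : H →L[ℂ] H,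
    (B : H →ₗ[ℂ] H) = M.compOp A T range_mem ∧ IsTraceClass B
  traceClass_adjoint : ∀ A ∈ M.alg, ∃ B : H →L[ℂ] H,
    (B : H →ₗ[ℂ] H) = M.compOp A (ContinuousLinearMap.adjoint T) adjoint_range_mem ∧
      IsTraceClass B

/-- A state of `M`: a positive operator in `T₁(M)` of trace one. -/
structure IsState (ρ : H →L[ℂ] H) : Prop where
  memT1 : M.MemT1 ρ
  isPositive : ρ.IsPositive
  trace_eq_one : opTrace (ρ : H →ₗ[ℂ] H) = 1

/-- The state space of `M`. -/
def StateSpace : Type _ := {ρ : H →L[ℂ] H // M.IsState ρ}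

/-- The expectation `Tr (A ρ)`. -/
def expectation (A : Module.End ℂ M.dom) (ρ : M.StateSpace) : ℂ :=
  opTrace (M.compOp A ρ.1 ρ.2.memT1.range_mem)

/-- The weak topology: the coarsest one for which `ρ ↦ Tr (A ρ)` is continuous for all `A ∈ M`. -/
instance instTopologicalSpaceStateSpace : TopologicalSpace M.StateSpace :=
  TopologicalSpace.induced (fun ρ (A : M.alg) => M.expectation A.1 ρ) inferInstance

theorem continuous_expectation (A : M.alg) : Continuous (M.expectation A.1) :=
  (continuous_apply A).comp
    (continuous_induced_dom (f := fun ρ (A : M.alg) => M.expectation A.1 ρ))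

/-- The function `a_Q(ρ) = Tr (A ρ)` on the state space; for symmetric `A` the trace is real. -/
def aQ (A : M.alg) : C(M.StateSpace, ℝ) :=
  ⟨fun ρ => (M.expectation A.1 ρ).re, Complex.continuous_re.comp (M.continuous_expectation A)⟩

end OStarAlgebra

/-! Dedekind reals in the topos of sheaves on `X`. The sections over `U` of the sheaf of Dedekind
reals are the continuous functions `C(U, ℝ)`. Statements about sections are read in
Kripke–Joyal semantics: existence and disjunction are local, a negation holds on `U` if the
statement holds on no non-empty open subset of `U`. -/

namespace SheafReal

variable {X : Type*} [TopologicalSpace X]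

/-- Restriction of sections. -/
def res {U V : Opens X} (h : V ≤ U) (f : C(U, ℝ)) : C(V, ℝ) :=
  ⟨fun x => f ⟨x.1, h x.2⟩, f.continuous.comp (by fun_prop)⟩

/-- The locally constant rational function `p` as a section. -/
def ratSection {U : Opens X} (p : LocallyConstant U ℚ) : C(U, ℝ) :=
  (p.map (fun q : ℚ => (q : ℝ))).toContinuousMap

/-- The locally constant integer function `p` as a section. -/
def intSection {U : Opens X} (p : LocallyConstant U ℤ) : C(U, ℝ) :=
  (p.map (fun m : ℤ => (m : ℝ))).toContinuousMap

/-- The rationals that are in the lower cut of `f` to full extent `U`. -/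
def lowerCut {U : Opens X} (f : C(U, ℝ)) : Set ℚ := {q | ∀ x, (q : ℝ) < f x}

/-- The rationals that are in the upper cut of `f` to full extent `U`. -/
def upperCut {U : Opens X} (f : C(U, ℝ)) : Set ℚ := {q | ∀ x, f x < (q : ℝ)}

/-- `f < g`: there is (locally) a rational in the upper cut of `f` and the lower cut of `g`. -/
def Lt {U : Opens X} (f g : C(U, ℝ)) : Prop :=
  ∀ x ∈ U, ∃ (V : Opens X) (h : V ≤ U), x ∈ V ∧
    ∃ q : ℚ, q ∈ upperCut (res h f) ∧ q ∈ lowerCut (res h g)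

/-- `f ≤ g`: the upper cut of `g` is contained in that of `f`, and the lower cut of `f` in that
of `g`, to every extent `V ⊆ U`. -/
def Le {U : Opens X} (f g : C(U, ℝ)) : Prop :=
  ∀ (V : Opens X) (h : V ≤ U),
    upperCut (res h g) ⊆ upperCut (res h f) ∧ lowerCut (res h f) ⊆ lowerCut (res h g)

/-- `f` is invertible in `R` over `U`. (Inverses are unique, so that for a subsheaf `R` local
existence of an inverse is the same as existence.) -/
def IsInvertible (R : ∀ U : Opens X, Set C(U, ℝ)) {U : Opens X} (f : C(U, ℝ)) : Prop :=
  ∃ b ∈ R U, f * b = 1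

/-- The sequence `s` of sections is Cauchy for the metric `|f - g|`. -/
def IsCauchy {U : Opens X} (s : ℕ → C(U, ℝ)) : Prop :=
  ∀ k : ℕ, 0 < k → ∀ x ∈ U, ∃ (V : Opens X) (h : V ≤ U), x ∈ V ∧
    ∃ N : ℕ, ∀ m ≥ N, ∀ n ≥ N,
      Lt (|res h (s m) - res h (s n)|) (ContinuousMap.const V (1 / (k : ℝ)))

/-- The sequence `s` of sections converges to `f` for the metric `|f - g|`. -/
def ConvergesTo {U : Opens X} (s : ℕ → C(U, ℝ)) (f : C(U, ℝ)) : Prop :=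
  ∀ k : ℕ, 0 < k → ∀ x ∈ U, ∃ (V : Opens X) (h : V ≤ U), x ∈ V ∧
    ∃ N : ℕ, ∀ n ≥ N, Lt (|res h (s n) - res h f|) (ContinuousMap.const V (1 / (k : ℝ)))

/-- `R` is a subsheaf of the sheaf of Dedekind reals: closed under restriction and collation. -/
structure IsSubsheaf (R : ∀ U : Opens X, Set C(U, ℝ)) : Prop where
  res_mem : ∀ {U V : Opens X} (h : V ≤ U), ∀ f ∈ R U, res h f ∈ R V
  mem_of_local : ∀ {U : Opens X} (f : C(U, ℝ)),
    (∀ x ∈ U, ∃ (V : Opens X) (h : V ≤ U), x ∈ V ∧ res h f ∈ R V) → f ∈ R U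

/-- `R` contains the sheaves of locally constant functions with values in `ℤ` and in `ℚ`. -/
structure ContainsRationals (R : ∀ U : Opens X, Set C(U, ℝ)) : Prop where
  int_mem : ∀ {U : Opens X} (p : LocallyConstant U ℤ), intSection p ∈ R U
  rat_mem : ∀ {U : Opens X} (p : LocallyConstant U ℚ), ratSection p ∈ R U

/-- `<` is a strict partial order and `≤` a partial order on `R`, both are subsheaves of `R × R`,
they are compatible with each other and with the orders of the sheaf of rationals. -/
structure IsOrdered (R : ∀ U : Opens X, Set C(U, ℝ)) : Prop where
  lt_irrefl : ∀ {U : Opens X}, U ≠ ⊥ → ∀ f ∈ R U, ¬ Lt f f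
  lt_trans : ∀ {U : Opens X}, ∀ f ∈ R U, ∀ g ∈ R U, ∀ k ∈ R U, Lt f g → Lt g k → Lt f k
  le_refl : ∀ {U : Opens X}, ∀ f ∈ R U, Le f f
  le_trans : ∀ {U : Opens X}, ∀ f ∈ R U, ∀ g ∈ R U, ∀ k ∈ R U, Le f g → Le g k → Le f k
  le_antisymm : ∀ {U : Opens X}, ∀ f ∈ R U, ∀ g ∈ R U, Le f g → Le g f → f = g
  lt_local : ∀ {U : Opens X}, ∀ f ∈ R U, ∀ g ∈ R U,
    (Lt f g ↔ ∀ x ∈ U, ∃ (V : Opens X) (h : V ≤ U), x ∈ V ∧ Lt (res h f) (res h g))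
  le_local : ∀ {U : Opens X}, ∀ f ∈ R U, ∀ g ∈ R U,
    (Le f g ↔ ∀ x ∈ U, ∃ (V : Opens X) (h : V ≤ U), x ∈ V ∧ Le (res h f) (res h g))
  le_iff_not_lt : ∀ {U : Opens X}, ∀ f ∈ R U, ∀ g ∈ R U,
    (Le f g ↔ ∀ (V : Opens X) (h : V ≤ U), V ≠ ⊥ → ¬ Lt (res h g) (res h f))
  lt_rat : ∀ {U : Opens X} (p q : LocallyConstant U ℚ),
    (Lt (ratSection p) (ratSection q) ↔ ∀ x, p x < q x)
  le_rat : ∀ {U : Opens X} (p q : LocallyConstant U ℚ),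
    (Le (ratSection p) (ratSection q) ↔ ∀ x, p x ≤ q x)

/-- `R` is a sheaf of rings with `0 ≠ 1` in which every non-invertible element is zero, and in which
`b` is invertible if and only if `|b| > 0`. -/
structure IsResidueApartnessField (R : ∀ U : Opens X, Set C(U, ℝ)) : Prop where
  isSubring : ∀ U : Opens X, ∃ S : Subring C(U, ℝ), (S : Set C(U, ℝ)) = R U
  zero_ne_one : ∀ {U : Opens X}, U ≠ ⊥ → (0 : C(U, ℝ)) ≠ 1
  residue : ∀ {U : Opens X}, ∀ f ∈ R U,
    (∀ (V : Opens X) (h : V ≤ U), V ≠ ⊥ → ¬ IsInvertible R (res h f)) → f = 0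
  apartness : ∀ {U : Opens X}, ∀ f ∈ R U, (Lt 0 |f| ↔ IsInvertible R f)

/-- `|f| = max(f, -f)` is a norm function on `R`, and `R` is complete for the metric
`d(f, g) = |f - g|`, with the sheaf of rationals dense in it. -/
structure IsCompleteMetric (R : ∀ U : Opens X, Set C(U, ℝ)) : Prop where
  abs_mem : ∀ {U : Opens X}, ∀ f ∈ R U, |f| ∈ R U
  le_abs : ∀ {U : Opens X}, ∀ f ∈ R U, Le f |f| ∧ Le (-f) |f|
  abs_le : ∀ {U : Opens X}, ∀ f ∈ R U, ∀ g ∈ R U, Le f g → Le (-f) g → Le |f| g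
  dist_nonneg : ∀ {U : Opens X}, ∀ f ∈ R U, ∀ g ∈ R U, Le 0 |f - g|
  dist_eq_zero : ∀ {U : Opens X}, ∀ f ∈ R U, ∀ g ∈ R U, (|f - g| = 0 ↔ f = g)
  dist_comm : ∀ {U : Opens X}, ∀ f ∈ R U, ∀ g ∈ R U, |f - g| = |g - f|
  dist_triangle : ∀ {U : Opens X}, ∀ f ∈ R U, ∀ g ∈ R U, ∀ k ∈ R U,
    Le |f - k| (|f - g| + |g - k|)
  complete : ∀ {U : Opens X} (s : ℕ → C(U, ℝ)), (∀ n, s n ∈ R U) → IsCauchy s →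
    ∃! f, f ∈ R U ∧ ConvergesTo s f
  rat_dense : ∀ {U : Opens X}, ∀ f ∈ R U, ∀ n : ℕ, 0 < n →
    ∀ x ∈ U, ∃ (V : Opens X) (h : V ≤ U), x ∈ V ∧
      ∃ q : LocallyConstant V ℚ, Lt (|res h f - ratSection q|) (ContinuousMap.const V (1 / (n : ℝ)))

/-- The subsheaf `R` of the sheaf of Dedekind reals on the non-empty space `X` is a continuum of
real numbers. -/
structure IsContinuum (R : ∀ U : Opens X, Set C(U, ℝ)) : Prop where
  nonempty : Nonempty X
  isSubsheaf : IsSubsheaf R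
  containsRationals : ContainsRationals R
  isOrdered : IsOrdered R
  isField : IsResidueApartnessField R
  isCompleteMetric : IsCompleteMetric R

/-- The subsheaf of Dedekind reals generated by `a`: its sections are the functions that are locally
of the form `F ∘ a` with `F : ℝ → ℝ` continuous. -/
def generatedBy (a : C(X, ℝ)) (U : Opens X) : Set C(U, ℝ) :=
  {f | ∀ x ∈ U, ∃ (V : Opens X) (h : V ≤ U), x ∈ V ∧
    ∃ F : C(ℝ, ℝ), ∀ y : V, res h f y = F (a y)}

/-- The section `a(W)`: the restriction of `a` to the open set `W`. -/
def sectionOn (a : C(X, ℝ)) (W : Opens X) : C(W, ℝ) :=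
  ⟨fun x => a x.1, a.continuous.comp continuous_subtype_val⟩

end SheafReal

end

/-! Sending a state to the vector of all its expectations induces the topology of `X`, has convex
range, and turns `a_Q` into a real-linear functional on that range. Everything follows from this
picture.

Vector states have expectations dense in `ℝ`, and the image of a convex set is an interval, so `a_Q`
is surjective. Since `a_Q` has no extreme value, short moves towards states with smaller and larger
value show that it is open (`isOpenMap_of_convex`). For an open map, a continuous function constant
on fibres descends to a continuous function on the image. Hence membership in `R` means being
constant on the fibres within some neighbourhood of each point (`mem_generatedBy_iff`), a property
kept by pointwise operations, including inversion where there are no zeros.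

Completeness is the delicate point: the neighbourhoods on which the terms of a sequence factor
through `a_Q` may shrink. Convex neighbourhoods meet the fibres in convex, hence connected sets, and
a section of `R`, being locally constant along fibres, is constant on these. So one neighbourhood
serves all terms, and the limit (`mem_generatedBy_of_convergesTo`).

The operator theory serves only to show that mixtures of states are states, for which sums of trace
class operators must be of trace class. -/

/-! ### Factorization and Hilbert–Schmidt operators -/

section HilbertSchmidt

variable {H : Type*} [NormedAddCommGroup H] [InnerProductSpace ℂ H]

open ContinuousLinearMap (adjoint)

/-- Douglas' factorization lemma. -/
theorem exists_eq_comp_of_norm_le [CompleteSpace H] (S T : H →L[ℂ] H) (h : ∀ x, ‖T x‖ ≤ ‖S x‖) :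
    ∃ C : H →L[ℂ] H, ∀ x, T x = C (S x) := by
  -- The bound makes `S x ↦ T x` a well-defined contraction on the range of `S`. It extends to the
  -- closure `K`, and by zero to the orthogonal complement.
  let K : Submodule ℂ H := (LinearMap.range (S : H →ₗ[ℂ] H)).topologicalClosure
  have hK : ∀ x, S x ∈ K := fun x => Submodule.le_topologicalClosure _ ⟨x, rfl⟩
  have : CompleteSpace K := (Submodule.isClosed_topologicalClosure _).completeSpace_coe
  let e : H →ₗ[ℂ] K := (S : H →ₗ[ℂ] H).codRestrict K hK
  have hd : DenseRange e := by
    intro y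
    have hy : (y : H) ∈ closure (Set.range S) := y.2
    rw [Topology.IsInducing.subtypeVal.closure_eq_preimage_closure_image]
    rw [← Set.range_comp]
    exact hy
  have hn : ∃ c : ℝ, ∀ x, ‖(T : H →ₗ[ℂ] H) x‖ ≤ c * ‖e x‖ :=
    ⟨1, fun x => by simpa [e] using h x⟩
  refine ⟨((T : H →ₗ[ℂ] H).extendOfNorm e) ∘L K.orthogonalProjectionOnto, fun x => ?_⟩
  have h1 : K.orthogonalProjectionOnto (S x) = e x :=
    K.orthogonalProjectionOnto_mem_subspace_eq_self (e x)
  rw [ContinuousLinearMap.comp_apply, h1, LinearMap.extendOfNorm_eq hd hn]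
  rfl

variable {ι : Type*} (b : HilbertBasis ι ℂ H)

theorem HilbertBasis.hasSum_norm_inner_sq (x : H) :
    HasSum (fun i => ‖⟪b i, x⟫_ℂ‖ ^ 2) (‖x‖ ^ 2) := by
  have h := Complex.hasSum_re (b.hasSum_inner_mul_inner x x)
  convert h using 1
  · ext i
    rw [← inner_conj_symm x (b i), ← Complex.normSq_eq_conj_mul_self, Complex.ofReal_re,
      Complex.normSq_eq_norm_sq]
  · exact (inner_self_eq_norm_sq (𝕜 := ℂ) x).symm

/-- The Hilbert–Schmidt condition passes to the adjoint. -/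
theorem HilbertBasis.summable_norm_sq_adjoint [CompleteSpace H] {T : H →L[ℂ] H}
    (hT : Summable fun i => ‖T (b i)‖ ^ 2) : Summable fun i => ‖adjoint T (b i)‖ ^ 2 := by
  -- Summed over `p.2` these squared matrix entries give `‖T (b i)‖ ^ 2`, summed over `p.1` they
  -- give `‖adjoint T (b j)‖ ^ 2`.
  let f : ι × ι → ℝ := fun p => ‖⟪b p.2, T (b p.1)⟫_ℂ‖ ^ 2
  have hf : 0 ≤ f := fun p => sq_nonneg _
  have hs : Summable f := by
    rw [summable_prod_of_nonneg hf]
    refine ⟨fun i => (b.hasSum_norm_inner_sq (T (b i))).summable, ?_⟩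
    simpa only [f, (b.hasSum_norm_inner_sq _).tsum_eq] using hT
  have hs' : Summable (f ∘ Prod.swap) := (Equiv.prodComm ι ι).summable_iff.mpr hs
  refine ((summable_prod_of_nonneg (f := f ∘ Prod.swap) fun p => hf p.swap).mp hs').2.congr fun i => ?_
  rw [← (b.hasSum_norm_inner_sq (adjoint T (b i))).tsum_eq]
  refine tsum_congr fun j => ?_
  simp only [f, Function.comp_apply, Prod.swap_prod_mk]
  rw [ContinuousLinearMap.adjoint_inner_right, ← inner_conj_symm, RCLike.norm_conj]

theorem HilbertBasis.summable_norm_sq_comp {T : H →L[ℂ] H} (C : H →L[ℂ] H)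
    (hT : Summable fun i => ‖T (b i)‖ ^ 2) : Summable fun i => ‖C (T (b i))‖ ^ 2 := by
  refine Summable.of_nonneg_of_le (fun i => sq_nonneg _) (fun i => ?_) (hT.mul_left (‖C‖ ^ 2))
  rw [← mul_pow]
  gcongr
  exact C.le_opNorm _

theorem HilbertBasis.summable_inner_of_norm_sq {S T : H →L[ℂ] H}
    (hS : Summable fun i => ‖S (b i)‖ ^ 2) (hT : Summable fun i => ‖T (b i)‖ ^ 2) :
    Summable fun i => ⟪S (b i), T (b i)⟫_ℂ := by
  refine Summable.of_norm_bounded (hS.add hT) fun i => ?_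
  have := norm_inner_le_norm (𝕜 := ℂ) (S (b i)) (T (b i))
  nlinarith [sq_nonneg (‖S (b i)‖ - ‖T (b i)‖), sq_nonneg (‖S (b i)‖ + ‖T (b i)‖)]

end HilbertSchmidt

/-! ### Trace class operators and linearity of the trace -/

section TraceClassCriterion

variable {H : Type*} [NormedAddCommGroup H] [InnerProductSpace ℂ H] [CompleteSpace H]

open ContinuousLinearMap (adjoint)

/-- Because `|T|² = T* T`. Douglas' lemma then factors `T` through `|T|` and conversely, which
replaces the polar decomposition. -/
theorem norm_cfcAbs_apply (T : H →L[ℂ] H) (x : H) : ‖CFC.abs T x‖ = ‖T x‖ := by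
  have h1 : adjoint (CFC.abs T) = CFC.abs T :=
    (IsSelfAdjoint.of_nonneg (CFC.abs_nonneg T)).star_eq
  have h2 : ⟪CFC.abs T x, CFC.abs T x⟫_ℂ = ⟪T x, T x⟫_ℂ := by
    have h3 : CFC.abs T (CFC.abs T x) = adjoint T (T x) :=
      congr($(CFC.abs_mul_abs T) x)
    rw [← ContinuousLinearMap.adjoint_inner_right, h1, h3,
      ContinuousLinearMap.adjoint_inner_right]
  rw [inner_self_eq_norm_sq_to_K, inner_self_eq_norm_sq_to_K] at h2
  have h3 : ‖CFC.abs T x‖ ^ 2 = ‖T x‖ ^ 2 := by exact_mod_cast h2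
  exact (sq_eq_sq₀ (norm_nonneg _) (norm_nonneg _)).mp h3

/-- An operator is of trace class iff all its products with bounded operators have absolutely
summable diagonals. -/
theorem isTraceClass_iff (T : H →L[ℂ] H) :
    IsTraceClass T ↔ ∀ C : H →L[ℂ] H,
      Summable fun i => ⟪stdHilbertBasis H i, C (T (stdHilbertBasis H i))⟫_ℂ := by
  constructor
  · intro hT C
    set b := stdHilbertBasis H
    obtain ⟨U, hU⟩ := exists_eq_comp_of_norm_le (CFC.abs T) T
      fun x => (norm_cfcAbs_apply T x).ge
    -- With `Q = √|T|`, the trace condition says that `Q` is Hilbert–Schmidt. Then `C T = (C U Q) Q`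
    -- is a product of two Hilbert–Schmidt operators.
    let Q : H →L[ℂ] H := CFC.sqrt (CFC.abs T)
    have hQQ : ∀ x, Q (Q x) = CFC.abs T x := fun x =>
      congr($(CFC.sqrt_mul_sqrt_self _ (CFC.abs_nonneg T)) x)
    have hQ : adjoint Q = Q := (IsSelfAdjoint.of_nonneg (CFC.sqrt_nonneg _)).star_eq
    have hQs : Summable fun i => ‖Q (b i)‖ ^ 2 := by
      refine hT.congr fun i => ?_
      rw [← hQQ, ← hQ, ContinuousLinearMap.adjoint_inner_right, hQ]
      exact inner_self_eq_norm_sq (𝕜 := ℂ) _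
    have h1 : Summable fun i => ‖(C ∘L U ∘L Q) (b i)‖ ^ 2 :=
      b.summable_norm_sq_comp (C ∘L U) hQs
    refine (b.summable_inner_of_norm_sq (b.summable_norm_sq_adjoint h1) hQs).congr fun i => ?_
    rw [ContinuousLinearMap.adjoint_inner_left, hU, ← hQQ]
    rfl
  · intro h
    -- Here `|T| = W T`, so the choice `C = W` recovers the definition.
    obtain ⟨W, hW⟩ := exists_eq_comp_of_norm_le T (CFC.abs T)
      fun x => (norm_cfcAbs_apply T x).le
    refine (Complex.hasSum_re (h W).hasSum).summable.congr fun i => ?_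
    rw [hW]

theorem IsTraceClass.summable_inner {T : H →L[ℂ] H} (hT : IsTraceClass T) :
    Summable fun i => ⟪stdHilbertBasis H i, T (stdHilbertBasis H i)⟫_ℂ :=
  (isTraceClass_iff T).mp hT (ContinuousLinearMap.id ℂ H)

/-- The modulus is not additive, but the criterion `isTraceClass_iff` is linear in the operator. -/
theorem IsTraceClass.add {S T : H →L[ℂ] H} (hS : IsTraceClass S) (hT : IsTraceClass T) :
    IsTraceClass (S + T) := by
  rw [isTraceClass_iff] at *
  intro C
  simpa [inner_add_right] using (hS C).add (hT C)

theorem IsTraceClass.smul {T : H →L[ℂ] H} (hT : IsTraceClass T) (c : ℂ) :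
    IsTraceClass (c • T) := by
  rw [isTraceClass_iff] at *
  intro C
  simpa [inner_smul_right] using (hT C).mul_left c

theorem isTraceClass_rankOne (u v : H) : IsTraceClass (InnerProductSpace.rankOne ℂ u v) := by
  rw [isTraceClass_iff]
  intro C
  simpa [inner_smul_right] using (stdHilbertBasis H).summable_inner_mul_inner v (C u)

theorem opTrace_rankOne (u v : H) :
    opTrace (InnerProductSpace.rankOne ℂ u v : H →ₗ[ℂ] H) = ⟪v, u⟫_ℂ := by
  simpa [opTrace, inner_smul_right] using (stdHilbertBasis H).tsum_inner_mul_inner v u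

theorem IsTraceClass.opTrace_add_smul {S T : H →L[ℂ] H} (hS : IsTraceClass S)
    (hT : IsTraceClass T) (c d : ℂ) :
    opTrace ((c • S + d • T : H →L[ℂ] H) : H →ₗ[ℂ] H) =
      c * opTrace (S : H →ₗ[ℂ] H) + d * opTrace (T : H →ₗ[ℂ] H) := by
  simp only [opTrace, ← tsum_mul_left]
  refine Eq.trans ?_ ((hS.summable_inner.mul_left c).tsum_add (hT.summable_inner.mul_left d))
  simp

end TraceClassCriterion

open scoped ComplexOrder in
/-- Positivity is preserved by scaling with nonnegative reals. -/
theorem ContinuousLinearMap.IsPositive.ofReal_smul {H : Type*} [NormedAddCommGroup H]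
    [InnerProductSpace ℂ H] {T : H →L[ℂ] H} (hT : T.IsPositive) {c : ℝ} (hc : 0 ≤ c) :
    ((c : ℂ) • T).IsPositive :=
  hT.smul_of_nonneg (by exact_mod_cast hc)

/-! ### Vector states and mixtures of states -/

namespace OStarAlgebra

variable {H : Type*} [NormedAddCommGroup H] [InnerProductSpace ℂ H] [CompleteSpace H]
  {M : OStarAlgebra H}

open ContinuousLinearMap (adjoint)

/-- A positive operator is self-adjoint, so the conditions on the adjoint repeat those on `ρ`. -/
theorem IsState.of_isPositive {ρ : H →L[ℂ] H} (hpos : ρ.IsPositive)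
    (hmem : ∀ x, ρ x ∈ M.dom)
    (htc : ∀ A ∈ M.alg, ∃ B : H →L[ℂ] H,
      (B : H →ₗ[ℂ] H) = M.compOp A ρ hmem ∧ IsTraceClass B)
    (htr : opTrace (ρ : H →ₗ[ℂ] H) = 1) : M.IsState ρ := by
  have hadj : adjoint ρ = ρ := hpos.isSelfAdjoint.star_eq
  have hmem' : ∀ x, adjoint ρ x ∈ M.dom := by rwa [hadj]
  refine ⟨⟨hmem, hmem', htc, fun A hA => ?_⟩, hpos, htr⟩
  obtain ⟨B, hB, hB'⟩ := htc A hA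
  refine ⟨B, hB.trans ?_, hB'⟩
  congr 1
  exact hadj.symm

/-- The state is the projection `|u⟩⟨u|`, for which `A ρ = |A u⟩⟨u|` has rank at most one and trace
`⟪u, A u⟫`. -/
theorem exists_state_of_norm_eq_one (u : M.dom) (hu : ‖u‖ = 1) :
    ∃ ρ : M.StateSpace, ∀ A : M.alg, M.expectation A.1 ρ = ⟪(u : H), (A.1 u : H)⟫_ℂ := by
  let ρ : H →L[ℂ] H := InnerProductSpace.rankOne ℂ (u : H) (u : H)
  have hmem : ∀ x, ρ x ∈ M.dom := fun x => M.dom.smul_mem _ u.2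
  have hcomp : ∀ A : Module.End ℂ M.dom, M.compOp A ρ hmem =
      (InnerProductSpace.rankOne ℂ (A u : H) (u : H) : H →L[ℂ] H) := by
    intro A
    ext x
    have : (ρ : H →ₗ[ℂ] H).codRestrict M.dom hmem x = ⟪(u : H), x⟫_ℂ • u := rfl
    simp [compOp, this]
  have hst : M.IsState ρ := by
    refine .of_isPositive (InnerProductSpace.isPositive_rankOne_self _) hmem
      (fun A _ => ⟨_, (hcomp A).symm, isTraceClass_rankOne _ _⟩) ?_
    rw [opTrace_rankOne, inner_self_eq_norm_sq_to_K]
    simp [show ‖(u : H)‖ = 1 from hu]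
  refine ⟨⟨ρ, hst⟩, fun A => ?_⟩
  exact (congrArg opTrace (hcomp A.1)).trans (opTrace_rankOne _ _)

theorem exists_state_convexComb (ρ σ : M.StateSpace) {s t : ℝ} (hs : 0 ≤ s) (ht : 0 ≤ t)
    (hst : s + t = 1) : ∃ τ : M.StateSpace, ∀ A : M.alg,
      M.expectation A.1 τ = s * M.expectation A.1 ρ + t * M.expectation A.1 σ := by
  let τ : H →L[ℂ] H := (s : ℂ) • ρ.1 + (t : ℂ) • σ.1
  have hmem : ∀ x, τ x ∈ M.dom := fun x => M.dom.add_mem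
    (M.dom.smul_mem _ (ρ.2.memT1.range_mem x)) (M.dom.smul_mem _ (σ.2.memT1.range_mem x))
  have key : ∀ A ∈ M.alg, ∃ B : H →L[ℂ] H, (B : H →ₗ[ℂ] H) = M.compOp A τ hmem ∧
      IsTraceClass B ∧ opTrace (B : H →ₗ[ℂ] H) =
        s * opTrace (M.compOp A ρ.1 ρ.2.memT1.range_mem) +
          t * opTrace (M.compOp A σ.1 σ.2.memT1.range_mem) := by
    intro A hA
    obtain ⟨B, hB, hB'⟩ := ρ.2.memT1.traceClass A hA
    obtain ⟨C, hC, hC'⟩ := σ.2.memT1.traceClass A hA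
    refine ⟨(s : ℂ) • B + (t : ℂ) • C, ?_, (hB'.smul _).add (hC'.smul _), ?_⟩
    · have h1 : ((s : ℂ) • B + (t : ℂ) • C : H →L[ℂ] H) =
          (s : ℂ) • (B : H →ₗ[ℂ] H) + (t : ℂ) • (C : H →ₗ[ℂ] H) := rfl
      rw [h1, hB, hC]
      ext x
      have h2 : (τ : H →ₗ[ℂ] H).codRestrict M.dom hmem x =
        (s : ℂ) • (ρ.1 : H →ₗ[ℂ] H).codRestrict M.dom ρ.2.memT1.range_mem x +
        (t : ℂ) • (σ.1 : H →ₗ[ℂ] H).codRestrict M.dom σ.2.memT1.range_mem x := rfl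
      simp only [compOp, LinearMap.add_apply, LinearMap.smul_apply, LinearMap.comp_apply, h2,
        map_add, map_smul]
    · rw [hB'.opTrace_add_smul hC', hB, hC]
  have hτ : M.IsState τ := by
    refine .of_isPositive ((ρ.2.isPositive.ofReal_smul hs).add
      (σ.2.isPositive.ofReal_smul ht)) hmem (fun A hA => ?_) ?_
    · obtain ⟨B, h1, h2, -⟩ := key A hA
      exact ⟨B, h1, h2⟩
    -- The trace of `τ` is its expectation of the unit of the algebra.
    · obtain ⟨B, h1, h2, h3⟩ := key 1 M.alg.one_mem
      have h4 : ∀ (T : H →L[ℂ] H) (h : ∀ x, T x ∈ M.dom),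
        M.compOp 1 T h = (T : H →ₗ[ℂ] H) := fun T h => rfl
      rw [← h4 τ hmem, ← h1, h3, h4, h4, ρ.2.trace_eq_one, σ.2.trace_eq_one]
      exact_mod_cast (by simpa using hst)
  refine ⟨⟨τ, hτ⟩, fun A => ?_⟩
  obtain ⟨B, h1, -, h3⟩ := key A.1 A.2
  exact (congrArg opTrace h1).symm.trans h3

end OStarAlgebra

/-! ### The internal orders as pointwise orders -/

namespace SheafReal

open Filter Topology

variable {X : Type*} [TopologicalSpace X]

section Order

variable {U : Opens X}

theorem exists_opens_of_isOpen {s : Set U} (hs : IsOpen s) {x : U} (hx : x ∈ s) :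
    ∃ (V : Opens X) (h : V ≤ U), x.1 ∈ V ∧ ∀ y : V, (⟨y.1, h y.2⟩ : U) ∈ s := by
  refine ⟨⟨Subtype.val '' s, U.isOpen.isOpenMap_subtype_val s hs⟩, ?_, ⟨x, hx, rfl⟩, ?_⟩
  · rintro _ ⟨y, -, rfl⟩
    exact y.2
  · rintro ⟨_, y, hy, rfl⟩
    exact hy

/-- A rational strictly between `f x` and `g x` still separates `f` and `g` near `x`. -/
theorem lt_iff {f g : C(U, ℝ)} : Lt f g ↔ ∀ x, f x < g x := by
  constructor
  · intro h x
    obtain ⟨V, hV, hx, q, hq, hq'⟩ := h x.1 x.2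
    exact (hq ⟨x, hx⟩).trans (hq' ⟨x, hx⟩)
  · intro h x hx
    obtain ⟨q, hq, hq'⟩ := exists_rat_btwn (h ⟨x, hx⟩)
    obtain ⟨V, hV, hxV, H⟩ := exists_opens_of_isOpen
      ((isOpen_lt f.continuous continuous_const).inter
        (isOpen_lt continuous_const g.continuous)) (x := ⟨x, hx⟩)
      (show _ ∈ {y | f y < q} ∩ {y | (q : ℝ) < g y} from ⟨hq, hq'⟩)
    exact ⟨V, hV, hxV, q, fun y => (H y).1, fun y => (H y).2⟩

theorem le_iff {f g : C(U, ℝ)} : Le f g ↔ ∀ x, f x ≤ g x := by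
  constructor
  · intro h x
    -- A rational `q` with `g x < q < f x` lies in the upper cut of `g` near `x`, but not in that of
    -- `f`.
    by_contra! hlt
    obtain ⟨q, hq, hq'⟩ := exists_rat_btwn hlt
    obtain ⟨V, hV, hxV, H⟩ := exists_opens_of_isOpen (isOpen_lt g.continuous continuous_const)
      (show x ∈ {y | g y < q} from hq)
    exact (((h V hV).1 (show q ∈ upperCut (res hV g) from H)) ⟨x, hxV⟩).not_gt hq'
  · intro h V hV
    exact ⟨fun q hq y => (h _).trans_lt (hq y), fun q hq y => (hq y).trans_le (h _)⟩

theorem le_iff_not_lt {f g : C(U, ℝ)} :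
    Le f g ↔ ∀ (V : Opens X) (h : V ≤ U), V ≠ ⊥ → ¬ Lt (res h g) (res h f) := by
  rw [le_iff]
  constructor
  · intro h V hV hne hlt
    obtain ⟨x, hx⟩ := V.ne_bot_iff_nonempty.mp hne
    exact ((lt_iff.mp hlt) ⟨x, hx⟩).not_ge (h ⟨x, hV hx⟩)
  · intro h x
    by_contra! hlt
    obtain ⟨V, hV, hxV, H⟩ := exists_opens_of_isOpen (isOpen_lt g.continuous f.continuous)
      (show x ∈ {y | g y < f y} from hlt)
    exact h V hV (V.ne_bot_iff_nonempty.mpr ⟨x, hxV⟩) (lt_iff.mpr H)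

end Order

theorem isOrdered (R : ∀ U : Opens X, Set C(U, ℝ)) : IsOrdered R where
  lt_irrefl := by
    intro U hU f _ h
    obtain ⟨x, hx⟩ := U.ne_bot_iff_nonempty.mp hU
    exact lt_irrefl _ (lt_iff.mp h ⟨x, hx⟩)
  lt_trans := by
    intro U f _ g _ k _
    simp only [lt_iff]
    exact fun h h' x => (h x).trans (h' x)
  le_refl := by
    intro U f _
    exact le_iff.mpr fun x => le_rfl
  le_trans := by
    intro U f _ g _ k _
    simp only [le_iff]
    exact fun h h' x => (h x).trans (h' x)
  le_antisymm := by
    intro U f _ g _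
    simp only [le_iff]
    exact fun h h' => ContinuousMap.ext fun x => (h x).antisymm (h' x)
  lt_local := by
    intro U f _ g _
    refine ⟨fun h x hx => ⟨U, le_rfl, hx, h⟩, fun h => lt_iff.mpr fun x => ?_⟩
    obtain ⟨V, hV, hx, H⟩ := h x.1 x.2
    exact lt_iff.mp H ⟨x, hx⟩
  le_local := by
    intro U f _ g _
    refine ⟨fun h x hx => ⟨U, le_rfl, hx, h⟩, fun h => le_iff.mpr fun x => ?_⟩
    obtain ⟨V, hV, hx, H⟩ := h x.1 x.2
    exact le_iff.mp H ⟨x, hx⟩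
  le_iff_not_lt := fun _ _ _ _ => le_iff_not_lt
  lt_rat := by
    intro U p q
    rw [lt_iff]
    exact forall_congr' fun x => Rat.cast_lt
  le_rat := by
    intro U p q
    rw [le_iff]
    exact forall_congr' fun x => Rat.cast_le

/-! ### Completeness of the sheaf of Dedekind reals -/

section Metric

variable {U : Opens X}

theorem IsCauchy.exists_forall_lt {s : ℕ → C(U, ℝ)} (hs : IsCauchy s) (x : U) {ε : ℝ}
    (hε : 0 < ε) : ∃ (V : Opens X) (h : V ≤ U), x.1 ∈ V ∧ ∃ N : ℕ, ∀ m ≥ N, ∀ n ≥ N, ∀ y : V,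
      |s m ⟨y, h y.2⟩ - s n ⟨y, h y.2⟩| < ε := by
  obtain ⟨k, hk⟩ := exists_nat_one_div_lt hε
  obtain ⟨V, hV, hx, N, hN⟩ := hs (k + 1) k.succ_pos x.1 x.2
  refine ⟨V, hV, hx, N, fun m hm n hn y => ?_⟩
  have h1 := lt_iff.mp (hN m hm n hn) y
  have h2 : |s m ⟨y, hV y.2⟩ - s n ⟨y, hV y.2⟩| < 1 / ((k + 1 : ℕ) : ℝ) := h1
  push_cast at h2
  exact h2.trans hk

theorem ConvergesTo.tendsto {s : ℕ → C(U, ℝ)} {f : C(U, ℝ)} (h : ConvergesTo s f) (x : U) :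
    Tendsto (fun n => s n x) atTop (𝓝 (f x)) := by
  rw [Metric.tendsto_atTop]
  intro ε hε
  obtain ⟨k, hk⟩ := exists_nat_one_div_lt hε
  obtain ⟨V, hV, hx, N, hN⟩ := h (k + 1) k.succ_pos x.1 x.2
  refine ⟨N, fun n hn => ?_⟩
  have h2 : |s n x - f x| < 1 / ((k + 1 : ℕ) : ℝ) := lt_iff.mp (hN n hn) ⟨x, hx⟩
  push_cast at h2
  exact h2.trans hk

/-- The sheaf of Dedekind reals is complete. -/
theorem IsCauchy.exists_convergesTo {s : ℕ → C(U, ℝ)} (hs : IsCauchy s) :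
    ∃ f : C(U, ℝ), ConvergesTo s f := by
  have hc : ∀ x : U, ∃ l, Tendsto (fun n => s n x) atTop (𝓝 l) := by
    intro x
    refine cauchySeq_tendsto_of_complete (Metric.cauchySeq_iff.mpr fun ε hε => ?_)
    obtain ⟨V, hV, hx, N, hN⟩ := hs.exists_forall_lt x hε
    exact ⟨N, fun m hm n hn => hN m hm n hn ⟨x, hx⟩⟩
  choose f hf using hc
  have happ : ∀ (x : U) {ε : ℝ}, 0 < ε → ∃ (V : Opens X) (h : V ≤ U), x.1 ∈ V ∧
      ∃ N : ℕ, ∀ n ≥ N, ∀ y : V, |s n ⟨y, h y.2⟩ - f ⟨y, h y.2⟩| < ε := by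
    intro x ε hε
    -- Letting `m → ∞` weakens `<` to `≤`, so the Cauchy estimate is taken with `ε / 2`.
    obtain ⟨V, hV, hx, N, hN⟩ := hs.exists_forall_lt x (half_pos hε)
    refine ⟨V, hV, hx, N, fun n hn y => lt_of_le_of_lt ?_ (half_lt_self hε)⟩
    refine le_of_tendsto ((tendsto_const_nhds.sub (hf ⟨y, hV y.2⟩)).abs) ?_
    filter_upwards [eventually_ge_atTop N] with m hm
    exact (hN n hn m hm y).le
  have hcont : Continuous f := by
    have : TendstoLocallyUniformly (fun n => ⇑(s n)) f atTop := by
      rw [Metric.tendstoLocallyUniformly_iff]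
      intro ε hε x
      obtain ⟨V, hV, hx, N, hN⟩ := happ x hε
      refine ⟨Subtype.val ⁻¹' (V : Set X),
        (V.isOpen.preimage continuous_subtype_val).mem_nhds hx, ?_⟩
      filter_upwards [eventually_ge_atTop N] with n hn y hy
      rw [dist_comm]
      exact hN n hn ⟨y, hy⟩
    exact this.continuous (Frequently.of_forall fun n => (s n).continuous)
  refine ⟨⟨f, hcont⟩, fun k hk x hx => ?_⟩
  obtain ⟨V, hV, hxV, N, hN⟩ := happ ⟨x, hx⟩ (ε := 1 / (k : ℝ)) (by positivity)
  exact ⟨V, hV, hxV, N, fun n hn => lt_iff.mpr (hN n hn)⟩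

end Metric

/-! ### The subsheaf generated by a function -/

section GeneratedBy

variable {a : C(X, ℝ)} {U : Opens X}

theorem exists_factor_of_fibrewise_constant (ha : IsOpenMap a) {V : Opens X} (f : C(V, ℝ))
    (hf : ∀ y z : V, a y = a z → f y = f z) (x : V) :
    ∃ (W : Opens X) (h : W ≤ V), x.1 ∈ W ∧ ∃ F : C(ℝ, ℝ), ∀ y : W, res h f y = F (a y) := by
  -- This is `f` descended to the image of `a`; the value `0` off the image is never used.
  let F₀ : ℝ → ℝ := Function.extend (fun y : V => a y) f 0
  have hF₀ : ∀ y : V, F₀ (a y) = f y :=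
    fun y => Function.FactorsThrough.extend_apply (fun y z h => hf y z h) 0 y
  have ha' : IsOpenMap fun y : V => a y := ha.comp V.isOpen.isOpenMap_subtype_val
  have hcont : ∀ t ∈ Set.range fun y : V => a y, ContinuousAt F₀ t := by
    rintro _ ⟨y, rfl⟩
    intro s hs
    simp only [hF₀] at hs
    rw [Filter.mem_map]
    -- Openness of `a` enters here: the image of a neighbourhood of `y` is a neighbourhood of `a y`.
    refine mem_of_superset (ha'.image_mem_nhds (f.continuous.continuousAt hs)) ?_
    rintro _ ⟨z, hz, rfl⟩
    simpa [hF₀] using hz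
  obtain ⟨ε, hε, hball⟩ := Metric.nhds_basis_closedBall.mem_iff.mp
    (ha'.isOpen_range.mem_nhds ⟨x, rfl⟩)
  rw [Real.closedBall_eq_Icc] at hball
  have hle : a x - ε ≤ a x + ε := by linarith
  -- `F₀` need not be continuous off the image, so it is cut down to a compact interval inside the
  -- image and extended by constants.
  let F : C(ℝ, ℝ) := ⟨Set.IccExtend hle ((Set.Icc (a x - ε) (a x + ε)).domRestrict F₀), by
    refine Continuous.Icc_extend' (continuousOn_iff_continuous_domRestrict.mp ?_)
    exact fun t ht => (hcont t (hball ht)).continuousWithinAt⟩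
  refine ⟨V ⊓ ⟨a ⁻¹' Set.Ioo (a x - ε) (a x + ε), isOpen_Ioo.preimage a.continuous⟩,
    inf_le_left, ⟨x.2, ?_⟩, F, fun y => ?_⟩
  · exact ⟨by linarith, by linarith⟩
  · have hy : a y ∈ Set.Icc (a x - ε) (a x + ε) := Set.Ioo_subset_Icc_self y.2.2
    have : F (a y) = F₀ (a y) :=
      (Set.IccExtend_of_mem hle (Set.domRestrict _ F₀) hy)
    rw [this]
    exact (hF₀ ⟨y, y.2.1⟩).symm

/-- For an open map `a`, the sections generated by `a` are the continuous functions that are locally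
constant along the fibres of `a`, uniformly in the fibre. -/
theorem mem_generatedBy_iff (ha : IsOpenMap a) {f : C(U, ℝ)} :
    f ∈ generatedBy a U ↔ ∀ x ∈ U, ∃ (V : Opens X) (h : V ≤ U), x ∈ V ∧
      ∀ y z : V, a y = a z → f ⟨y, h y.2⟩ = f ⟨z, h z.2⟩ := by
  constructor
  · intro hf x hx
    obtain ⟨V, hV, hxV, F, hF⟩ := hf x hx
    refine ⟨V, hV, hxV, fun y z hyz => ?_⟩
    exact (hF y).trans ((congrArg F hyz).trans (hF z).symm)
  · intro hf x hx
    obtain ⟨V, hV, hxV, H⟩ := hf x hx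
    obtain ⟨W, hW, hxW, F, hF⟩ := exists_factor_of_fibrewise_constant ha (res hV f) H ⟨x, hxV⟩
    exact ⟨W, hW.trans hV, hxW, F, hF⟩

/-- Sections generated by `a` are constant on connected pieces of the fibres of `a`. -/
theorem eq_of_mem_generatedBy {f : C(U, ℝ)} (hf : f ∈ generatedBy a U) {V : Opens X} (h : V ≤ U)
    (hV : ∀ t, IsPreconnected ((V : Set X) ∩ a ⁻¹' {t})) (y z : V) (hyz : a y = a z) :
    f ⟨y, h y.2⟩ = f ⟨z, h z.2⟩ := by
  -- Equality of the values of `f`, as a relation on all of `X`. It holds near each point of a fibre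
  -- piece and is transitive, hence holds throughout a connected piece.
  let P : X → X → Prop := fun p q => ∃ (hp : p ∈ U) (hq : q ∈ U), f ⟨p, hp⟩ = f ⟨q, hq⟩
  have key : P y z := by
    refine (hV (a z)).induction₂' P ?_ ?_ ⟨y.2, hyz⟩ ⟨z.2, rfl⟩
    · rintro p ⟨hp, hpa⟩
      obtain ⟨W, hW, hpW, F, hF⟩ := hf p (h hp)
      filter_upwards [inter_mem_nhdsWithin _ (W.isOpen.mem_nhds hpW)]
      rintro q ⟨⟨hqV, hqa⟩, hqW⟩
      have h1 : a p = a q := hpa.trans (Eq.symm hqa)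
      have h2 : f ⟨p, h hp⟩ = f ⟨q, h hqV⟩ :=
        (hF ⟨p, hpW⟩).trans ((congrArg F h1).trans (hF ⟨q, hqW⟩).symm)
      exact ⟨⟨h hp, h hqV, h2⟩, h hqV, h hp, h2.symm⟩
    · rintro p q r - - - ⟨hp, hq, h1⟩ ⟨_, hr, h2⟩
      exact ⟨hp, hr, h1.trans h2⟩
  obtain ⟨_, _, h1⟩ := key
  exact h1

/-- The operations on sections that are defined pointwise preserve the sections generated by an open
map. -/
theorem mem_generatedBy_of_pointwise (ha : IsOpenMap a) {f g k : C(U, ℝ)}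
    (hf : f ∈ generatedBy a U) (hg : g ∈ generatedBy a U)
    (h : ∀ x y, f x = f y → g x = g y → k x = k y) : k ∈ generatedBy a U := by
  rw [mem_generatedBy_iff ha] at *
  intro x hx
  obtain ⟨V, hV, hxV, HV⟩ := hf x hx
  obtain ⟨W, hW, hxW, HW⟩ := hg x hx
  exact ⟨V ⊓ W, inf_le_left.trans hV, ⟨hxV, hxW⟩, fun y z hyz =>
    h _ _ (HV ⟨y, y.2.1⟩ ⟨z, z.2.1⟩ hyz) (HW ⟨y, y.2.2⟩ ⟨z, z.2.2⟩ hyz)⟩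

theorem mem_generatedBy_of_isLocallyConstant {f : C(U, ℝ)} (hf : IsLocallyConstant f) :
    f ∈ generatedBy a U := by
  intro x hx
  obtain ⟨V, hV, hxV, H⟩ := exists_opens_of_isOpen (hf.isOpen_fiber (f ⟨x, hx⟩))
    (x := ⟨x, hx⟩) rfl
  exact ⟨V, hV, hxV, ContinuousMap.const ℝ (f ⟨x, hx⟩), H⟩

theorem const_mem_generatedBy (c : ℝ) : ContinuousMap.const U c ∈ generatedBy a U :=
  mem_generatedBy_of_isLocallyConstant (IsLocallyConstant.const c)

theorem isSubsheaf_generatedBy (a : C(X, ℝ)) : IsSubsheaf (generatedBy a) where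
  res_mem := by
    intro U V h f hf x hx
    obtain ⟨W, hW, hxW, F, hF⟩ := hf x (h hx)
    exact ⟨V ⊓ W, inf_le_left, ⟨hx, hxW⟩, F, fun y => hF ⟨y, y.2.2⟩⟩
  mem_of_local := by
    intro U f H x hx
    obtain ⟨V, hV, hxV, hf⟩ := H x hx
    obtain ⟨W, hW, hxW, F, hF⟩ := hf x hxV
    exact ⟨W, hW.trans hV, hxW, F, hF⟩

theorem containsRationals_generatedBy (a : C(X, ℝ)) : ContainsRationals (generatedBy a) where
  int_mem p := mem_generatedBy_of_isLocallyConstant (p.map fun m : ℤ => (m : ℝ)).isLocallyConstant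
  rat_mem p := mem_generatedBy_of_isLocallyConstant (p.map fun q : ℚ => (q : ℝ)).isLocallyConstant

theorem isInvertible_generatedBy_iff (ha : IsOpenMap a) {f : C(U, ℝ)} (hf : f ∈ generatedBy a U) :
    IsInvertible (generatedBy a) f ↔ ∀ x, f x ≠ 0 := by
  constructor
  · rintro ⟨b, -, hb⟩ x hx
    have : f x * b x = 1 := congr($hb x)
    simp [hx] at this
  · intro h
    refine ⟨⟨fun x => (f x)⁻¹, f.continuous.inv₀ h⟩,
      mem_generatedBy_of_pointwise ha hf hf fun x y hxy _ => congrArg Inv.inv hxy, ?_⟩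
    ext x
    exact mul_inv_cancel₀ (h x)

theorem isResidueApartnessField_generatedBy (ha : IsOpenMap a) :
    IsResidueApartnessField (generatedBy a) where
  isSubring U :=
    ⟨{ carrier := generatedBy a U
       mul_mem' := fun hf hg => mem_generatedBy_of_pointwise ha hf hg
         fun x y h h' => congrArg₂ (· * ·) h h'
       add_mem' := fun hf hg => mem_generatedBy_of_pointwise ha hf hg
         fun x y h h' => congrArg₂ (· + ·) h h'
       neg_mem' := fun hf => mem_generatedBy_of_pointwise ha hf hf
         fun x y h _ => congrArg Neg.neg h
       one_mem' := const_mem_generatedBy 1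
       zero_mem' := const_mem_generatedBy 0 }, rfl⟩
  zero_ne_one := by
    intro U hU h
    obtain ⟨x, hx⟩ := U.ne_bot_iff_nonempty.mp hU
    exact _root_.zero_ne_one (α := ℝ) congr($h ⟨x, hx⟩)
  residue := by
    intro U f hf H
    ext x
    by_contra hne
    -- Where `f` is non-zero it is so on a neighbourhood, and there it is invertible.
    obtain ⟨V, hV, hxV, hne'⟩ := exists_opens_of_isOpen
      (isOpen_ne_fun f.continuous continuous_const) (show x ∈ {y | f y ≠ 0} from hne)
    exact H V hV (V.ne_bot_iff_nonempty.mpr ⟨x, hxV⟩)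
      ((isInvertible_generatedBy_iff ha ((isSubsheaf_generatedBy a).res_mem hV f hf)).mpr hne')
  apartness := by
    intro U f hf
    rw [isInvertible_generatedBy_iff ha hf, lt_iff]
    exact forall_congr' fun x => abs_pos

/-- A function `a` has locally connected fibres if the open sets that meet all its fibres in connected
sets form a basis. -/
def HasLocallyConnectedFibres (a : C(X, ℝ)) : Prop :=
  ∀ (U : Opens X), ∀ x ∈ U, ∃ V ≤ U, x ∈ V ∧ ∀ t, IsPreconnected ((V : Set X) ∩ a ⁻¹' {t})

/-- The neighbourhood `V` with connected fibre pieces depends on `x` alone. Every `s n` is constant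
on these pieces, and so is the pointwise limit. -/
theorem mem_generatedBy_of_convergesTo (ha : IsOpenMap a) (hc : HasLocallyConnectedFibres a)
    {s : ℕ → C(U, ℝ)} (hs : ∀ n, s n ∈ generatedBy a U) {f : C(U, ℝ)} (h : ConvergesTo s f) :
    f ∈ generatedBy a U := by
  rw [mem_generatedBy_iff ha]
  intro x hx
  obtain ⟨V, hV, hxV, H⟩ := hc U x hx
  refine ⟨V, hV, hxV, fun y z hyz => ?_⟩
  refine tendsto_nhds_unique (h.tendsto _) ((h.tendsto ⟨z, hV z.2⟩).congr fun n => ?_)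
  exact (eq_of_mem_generatedBy (hs n) hV H y z hyz).symm

theorem isCompleteMetric_generatedBy (ha : IsOpenMap a) (hc : HasLocallyConnectedFibres a) :
    IsCompleteMetric (generatedBy a) where
  abs_mem := fun f hf => mem_generatedBy_of_pointwise ha hf hf fun x y h _ => congrArg abs h
  le_abs := fun f _ => ⟨le_iff.mpr fun x => le_abs_self (f x), le_iff.mpr fun x => neg_le_abs (f x)⟩
  abs_le := by
    intro U f _ g _
    simp only [le_iff]
    exact fun h h' x => abs_le'.mpr ⟨h x, h' x⟩
  dist_nonneg := fun f _ g _ => le_iff.mpr fun x => abs_nonneg (f x - g x)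
  dist_eq_zero := by
    intro U f _ g _
    simp only [ContinuousMap.ext_iff]
    exact forall_congr' fun x => abs_eq_zero.trans sub_eq_zero
  dist_comm := fun f _ g _ => abs_sub_comm f g
  dist_triangle := fun f _ g _ k _ => le_iff.mpr fun x => abs_sub_le (f x) (g x) (k x)
  complete := by
    intro U s hs hC
    obtain ⟨f, hf⟩ := hC.exists_convergesTo
    refine ⟨f, ⟨mem_generatedBy_of_convergesTo ha hc hs hf, hf⟩, ?_⟩
    rintro g ⟨-, hg⟩
    ext x
    exact tendsto_nhds_unique (hg.tendsto x) (hf.tendsto x)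
  rat_dense := by
    intro U f _ n hn x hx
    have hpos : (0 : ℝ) < 1 / n := by positivity
    obtain ⟨q, hq, hq'⟩ := exists_rat_btwn (lt_add_of_pos_right (f ⟨x, hx⟩) hpos)
    obtain ⟨V, hV, hxV, H⟩ := exists_opens_of_isOpen
      (isOpen_lt (f.continuous.sub continuous_const).abs continuous_const) (x := ⟨x, hx⟩)
      (show _ ∈ {y | |f y - q| < 1 / n} from by
        rw [Set.mem_ofPred_eq, abs_sub_lt_iff]
        constructor <;> linarith)
    exact ⟨V, hV, hxV, LocallyConstant.const V q, lt_iff.mpr H⟩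

theorem isContinuum_generatedBy [Nonempty X] (ha : IsOpenMap a)
    (hc : HasLocallyConnectedFibres a) : IsContinuum (generatedBy a) where
  nonempty := inferInstance
  isSubsheaf := isSubsheaf_generatedBy a
  containsRationals := containsRationals_generatedBy a
  isOrdered := isOrdered _
  isField := isResidueApartnessField_generatedBy ha
  isCompleteMetric := isCompleteMetric_generatedBy ha hc

theorem infinite_setOf_lt_sectionOn_lt (ha : Function.Surjective a) {r₁ r₂ : ℝ} (h : r₁ < r₂) :
    {W : Opens X | W ≠ ⊥ ∧ Lt (ContinuousMap.const W r₁) (sectionOn a W) ∧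
      Lt (sectionOn a W) (ContinuousMap.const W r₂)}.Infinite := by
  have : Infinite (Set.Ioo r₁ r₂) := Set.infinite_coe_iff.mpr (Set.Ioo_infinite h)
  -- By surjectivity of `a`, these open sets determine the interval `(r₁, s)` and so its supremum
  -- `s`.
  let W : Set.Ioo r₁ r₂ → Opens X :=
    fun s => ⟨a ⁻¹' Set.Ioo r₁ s, isOpen_Ioo.preimage a.continuous⟩
  refine Set.infinite_of_injective_forall_mem (f := W) (fun s t hst => ?_) fun s => ⟨?_, ?_, ?_⟩
  · have h1 : a ⁻¹' Set.Ioo r₁ s = a ⁻¹' Set.Ioo r₁ t := congrArg SetLike.coe hst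
    have h2 := ha.preimage_injective h1
    have h3 := congrArg sSup h2
    rw [csSup_Ioo s.2.1, csSup_Ioo t.2.1] at h3
    exact Subtype.ext h3
  · obtain ⟨t, ht⟩ := exists_between s.2.1
    obtain ⟨x, rfl⟩ := ha t
    exact (Opens.ne_bot_iff_nonempty _).mpr ⟨x, ht⟩
  · exact lt_iff.mpr fun y => y.2.1
  · exact lt_iff.mpr fun y => y.2.2.trans s.2.2

end GeneratedBy

/-! ### Affine functions on spaces with convex image -/

section Convex

variable {E : Type*} [AddCommGroup E] [Module ℝ E] [TopologicalSpace E] {e : X → E}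

/-- The image under `e` of a fibre piece is an intersection of three convex sets: a convex open set,
a level set of `l` and the range of `e`. Connectedness passes back because `e` is inducing. -/
theorem hasLocallyConnectedFibres_of_convex [IsTopologicalAddGroup E] [ContinuousSMul ℝ E]
    [LocallyConvexSpace ℝ E] (he : IsInducing e)
    (hconv : Convex ℝ (Set.range e)) (l : E →ₗ[ℝ] ℝ) {a : C(X, ℝ)} (ha : ∀ x, a x = l (e x)) :
    HasLocallyConnectedFibres a := by
  intro U x hx
  obtain ⟨O, hO, hOU⟩ := he.isOpen_iff.mp U.isOpen
  have hxO : e x ∈ O := by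
    have : x ∈ e ⁻¹' O := by rw [hOU]; exact hx
    exact this
  obtain ⟨D, ⟨hxD, hDc⟩, hDO⟩ :=
    (LocallyConvexSpace.convex_basis (𝕜 := ℝ) (e x)).mem_iff.mp (hO.mem_nhds hxO)
  obtain ⟨C, hxC, hCo, hCc, hCO⟩ : ∃ C, e x ∈ C ∧ IsOpen C ∧ Convex ℝ C ∧ C ⊆ O :=
    ⟨interior D, mem_interior_iff_mem_nhds.mpr hxD, isOpen_interior, hDc.interior,
      interior_subset.trans hDO⟩
  refine ⟨⟨e ⁻¹' C, hCo.preimage he.continuous⟩, fun y hy => ?_, hxC, fun t => ?_⟩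
  · have : y ∈ e ⁻¹' O := hCO hy
    rwa [hOU] at this
  · have h1 : (e ⁻¹' C ∩ a ⁻¹' {t}) = e ⁻¹' (C ∩ l ⁻¹' {t}) := by
      ext y
      simp [ha]
    change IsPreconnected (e ⁻¹' C ∩ a ⁻¹' {t})
    rw [h1, ← he.isPreconnected_image, Set.image_preimage_eq_inter_range]
    exact ((hCc.inter ((convex_singleton t).linear_preimage l)).inter hconv).isPreconnected

/-- Moving from `e x` the proportion `r` of the way to `e y` stays in the range, changes `l`
linearly, and stays near `e x` for small `r`. -/
theorem eventually_mem_image_of_convex [IsTopologicalAddGroup E] [ContinuousSMul ℝ E]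
    (he : IsInducing e) (hconv : Convex ℝ (Set.range e)) (l : E →ₗ[ℝ] ℝ) {a : X → ℝ}
    (ha : ∀ x, a x = l (e x)) (x y : X) {s : Set X} (hs : s ∈ 𝓝 x) :
    ∀ᶠ r : ℝ in 𝓝[≥] 0, a x + r * (a y - a x) ∈ a '' s := by
  rw [he.nhds_eq_comap] at hs
  obtain ⟨O, hO, hOs⟩ := hs
  have hc : Tendsto (fun r : ℝ => e x + r • (e y - e x)) (𝓝[≥] 0) (𝓝 (e x)) := by
    have : Continuous fun r : ℝ => e x + r • (e y - e x) := by fun_prop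
    simpa using (this.tendsto 0).mono_left nhdsWithin_le_nhds
  filter_upwards [hc hO, Icc_mem_nhdsGE (zero_lt_one' ℝ)] with r hr hr'
  obtain ⟨z, hz⟩ := hconv.add_smul_sub_mem ⟨x, rfl⟩ ⟨y, rfl⟩ hr'
  refine ⟨z, hOs ?_, ?_⟩
  · rw [Set.mem_preimage, hz]
    exact hr
  · simp [ha, hz]

theorem isOpenMap_of_convex [IsTopologicalAddGroup E] [ContinuousSMul ℝ E]
    (he : IsInducing e) (hconv : Convex ℝ (Set.range e)) (l : E →ₗ[ℝ] ℝ) {a : X → ℝ}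
    (ha : ∀ x, a x = l (e x)) (hsurj : Function.Surjective a) : IsOpenMap a := by
  rw [isOpenMap_iff_nhds_le]
  intro x s hs
  refine mem_of_superset ?_ (Set.image_preimage_subset a s)
  rw [Filter.mem_map] at hs
  rw [← nhdsLE_sup_nhdsGE, Filter.mem_sup]
  -- With values at distance exactly `1` from `a x`, the parameter `r` of the segment equals the
  -- displacement `|t - a x|`.
  obtain ⟨y, hy⟩ := hsurj (a x - 1)
  obtain ⟨z, hz⟩ := hsurj (a x + 1)
  constructor
  · have ht : Tendsto (fun t => a x - t) (𝓝[≤] (a x)) (𝓝[≥] 0) := by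
      refine tendsto_nhdsWithin_iff.mpr
        ⟨?_, eventually_mem_nhdsWithin.mono fun t ht => sub_nonneg.mpr (Set.mem_Iic.mp ht)⟩
      have : Continuous fun t => a x - t := by fun_prop
      simpa using (this.tendsto (a x)).mono_left nhdsWithin_le_nhds
    filter_upwards [ht.eventually (eventually_mem_image_of_convex he hconv l ha x y hs)] with t ht
    simpa [hy] using ht
  · have ht : Tendsto (fun t => t - a x) (𝓝[≥] (a x)) (𝓝[≥] 0) := by
      refine tendsto_nhdsWithin_iff.mpr
        ⟨?_, eventually_mem_nhdsWithin.mono fun t ht => sub_nonneg.mpr (Set.mem_Ici.mp ht)⟩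
      have : Continuous fun t => t - a x := by fun_prop
      simpa using (this.tendsto (a x)).mono_left nhdsWithin_le_nhds
    filter_upwards [ht.eventually (eventually_mem_image_of_convex he hconv l ha x z hs)] with t ht
    simpa [hz] using ht

/-- The linear image of a convex set is an interval, here unbounded on both sides. -/
theorem surjective_of_convex {X E : Type*} [AddCommGroup E] [Module ℝ E] {e : X → E}
    (hconv : Convex ℝ (Set.range e)) (l : E →ₗ[ℝ] ℝ) {a : X → ℝ}
    (ha : ∀ x, a x = l (e x)) (hlt : ∀ t, ∃ x, a x < t) (hgt : ∀ t, ∃ x, t < a x) :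
    Function.Surjective a := by
  intro t
  obtain ⟨x, hx⟩ := hlt t
  obtain ⟨y, hy⟩ := hgt t
  have h1 : l '' Set.range e = Set.range a := by
    rw [← Set.range_comp]
    exact congrArg Set.range (funext fun x => (ha x).symm)
  have h2 : (Set.range a).OrdConnected := h1 ▸ (hconv.linear_image l).ordConnected
  exact h2.out ⟨x, rfl⟩ ⟨y, rfl⟩ ⟨hx.le, hy.le⟩

end Convex

end SheafReal

/-! ### The state space and its expectation functions -/

namespace OStarAlgebra

open Topology

variable {H : Type*} [NormedAddCommGroup H] [InnerProductSpace ℂ H] [CompleteSpace H]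
  (M : OStarAlgebra H)

/-- The vector of all expectations of a state. -/
noncomputable def expectations (ρ : M.StateSpace) (A : M.alg) : ℂ := M.expectation A.1 ρ

theorem isInducing_expectations : IsInducing M.expectations := ⟨rfl⟩

theorem convex_range_expectations : Convex ℝ (Set.range M.expectations) := by
  rintro _ ⟨ρ, rfl⟩ _ ⟨σ, rfl⟩ s t hs ht hst
  obtain ⟨τ, hτ⟩ := exists_state_convexComb ρ σ hs ht hst
  refine ⟨τ, funext fun A => ?_⟩
  simpa [expectations] using hτ A

variable {M}

/-- Vector states realize the numerical range, whose closure contains every real number. -/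
theorem exists_aQ_mem_of_isOpen {A : M.alg}
    (hrange : closure (M.numericalRange A.1) = Set.range (fun t : ℝ => (t : ℂ)))
    {s : Set ℝ} (hs : IsOpen s) (hne : s.Nonempty) : ∃ ρ, M.aQ A ρ ∈ s := by
  obtain ⟨t, ht⟩ := hne
  have h1 : (t : ℂ) ∈ closure (M.numericalRange A.1) := hrange ▸ ⟨t, rfl⟩
  obtain ⟨z, hz, u, hu, rfl⟩ := mem_closure_iff.mp h1 (Complex.re ⁻¹' s)
    (hs.preimage Complex.continuous_re) (by simpa using ht)
  obtain ⟨ρ, hρ⟩ := exists_state_of_norm_eq_one u hu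
  refine ⟨ρ, ?_⟩
  change (M.expectation A.1 ρ).re ∈ s
  rwa [hρ A]

end OStarAlgebra

theorem proposition29 {H : Type*} [NormedAddCommGroup H] [InnerProductSpace ℂ H] [CompleteSpace H]
    (M : OStarAlgebra H) (A : M.alg) (hA : M.IsEssentiallySelfAdjoint A.1)
    (hrange : closure (M.numericalRange A.1) = Set.range (fun t : ℝ => (t : ℂ))) :
    SheafReal.IsContinuum (SheafReal.generatedBy (M.aQ A)) ∧
      ∀ r₁ r₂ : ℚ, r₁ < r₂ →
        {W : Opens M.StateSpace | W ≠ ⊥ ∧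
          SheafReal.Lt (ContinuousMap.const W (r₁ : ℝ)) (SheafReal.sectionOn (M.aQ A) W) ∧
          SheafReal.Lt (SheafReal.sectionOn (M.aQ A) W)
            (ContinuousMap.const W (r₂ : ℝ))}.Infinite := by
  let l : (M.alg → ℂ) →ₗ[ℝ] ℝ := Complex.reLm ∘ₗ LinearMap.proj A
  have hl : ∀ ρ, M.aQ A ρ = l (M.expectations ρ) := fun ρ => rfl
  have hsurj : Function.Surjective (M.aQ A) :=
    SheafReal.surjective_of_convex M.convex_range_expectations l hl
      (fun t => OStarAlgebra.exists_aQ_mem_of_isOpen hrange isOpen_Iio Set.nonempty_Iio)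
      (fun t => OStarAlgebra.exists_aQ_mem_of_isOpen hrange isOpen_Ioi Set.nonempty_Ioi)
  have : Nonempty M.StateSpace := (hsurj 0).nonempty
  refine ⟨SheafReal.isContinuum_generatedBy ?_ ?_, fun r₁ r₂ h => ?_⟩
  · exact SheafReal.isOpenMap_of_convex M.isInducing_expectations M.convex_range_expectations l
      hl hsurj
  · exact SheafReal.hasLocallyConnectedFibres_of_convex M.isInducing_expectations
      M.convex_range_expectations l hl
  · exact SheafReal.infinite_setOf_lt_sectionOn_lt hsurj (Rat.cast_lt.mpr h)
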